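/- Let $n\ge 1$ and let $\mathbb B^n$ be the open Euclidean unit ball of $\mathbb C^n$, with coordinates $z_k=x_k+iy_k$. Let $p\in[2,\infty)$ and $\lambda\in[0,4n/p)$. Let $\omega:[0,\infty)\to[0,\infty)$ be a majorant, that is, a continuous increasing function with $\omega(0)=0$ such that $\omega(t)/t$ is non-increasing for $t>0$. Let $f:\mathbb B^n\to\mathbb C$ be twice continuously differentiable (in the real sense) and satisfy $\Delta f=\lambda f$ in $\mathbb B^n$, where $\Delta=\sum_{k=1}^n\left(\frac{\partial^2}{\partial x_k^2}+\frac{\partial^2}{\partial y_k^2}\right)$. Write $$|\widetilde\nabla f|=\Big(\sum_{k=1}^n |f_{z_k}|^2+\sum_{k=1}^n|f_{\overline z_k}|^2\Big)^{1/2},\qquad f_{z_k}=\tfrac12\Big(\frac{\partial f}{\partial x_k}-i\frac{\partial f}{\partial y_k}\Big),\quad f_{\overline z_k}=\tfrac12\Big(\frac{\partial f}{\partial x_k}+i\frac{\partial f}{\partial y_k}\Big),$$ and, for $0<r<1$, $$M_p(r,g)=\Big(\int_{\partial\mathbb B^n}|g(r\zeta)|^p\,d\sigma(\zeta)\Big)^{1/p},$$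 where $\sigma$ is the normalized surface measure on $\partial\mathbb B^n$. Let $C>0$ be a constant such that $$M_p(r,\widetilde\nabla f)\le C\,\omega\Big(\frac1{1-r}\Big)\qquad\text{for all } r\in(0,1).$$ Then for all $r\in(0,1)$ $$M_p(r,f)\le\Big(\frac{4n}{4n-p\lambda}\Big)^{1/2}\Big(|f(0)|^2+2p(p-1)C^2\,\omega(1)\,T(r)\Big)^{1/2},\qquad\text{where } T(r)=\int_0^1\omega\Big(\frac1{1-\rho r}\Big)\,d\rho .$$ -/

import Mathlib

open MeasureTheory Set

noncomputable section

namespace Yukawa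

/-- `ℂⁿ` with its Euclidean norm `|z| = (∑ |z_k|²)^{1/2}`. It is also a real inner product space
of dimension `2n`, and real derivatives, the Laplacian and Lebesgue measure refer to that
structure. -/
abbrev Cn (n : ℕ) : Type := EuclideanSpace ℂ (Fin n)

/-- The open unit ball of `ℂⁿ`. -/
abbrev unitBall (n : ℕ) : Set (Cn n) := Metric.ball 0 1

/-- The partial derivative `∂f/∂x_k`, where `z_k = x_k + i y_k`. -/
def partialX {n : ℕ} (f : Cn n → ℂ) (k : Fin n) (z : Cn n) : ℂ :=
  fderiv ℝ f z (EuclideanSpace.single k 1)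

/-- The partial derivative `∂f/∂y_k`, where `z_k = x_k + i y_k`. -/
def partialY {n : ℕ} (f : Cn n → ℂ) (k : Fin n) (z : Cn n) : ℂ :=
  fderiv ℝ f z (EuclideanSpace.single k Complex.I)

/-- The Wirtinger derivative `f_{z_k} = (∂f/∂x_k - i ∂f/∂y_k) / 2`. -/
def wirtinger {n : ℕ} (f : Cn n → ℂ) (k : Fin n) (z : Cn n) : ℂ :=
  (partialX f k z - Complex.I * partialY f k z) / 2

/-- The conjugate Wirtinger derivative `f_{z̄_k} = (∂f/∂x_k + i ∂f/∂y_k) / 2`. -/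
def wirtingerBar {n : ℕ} (f : Cn n → ℂ) (k : Fin n) (z : Cn n) : ℂ :=
  (partialX f k z + Complex.I * partialY f k z) / 2

/-- The Hilbert-Schmidt norm `(|f_z|² + |f_{z̄}|²)^{1/2}` of the full gradient
`(f_z, f_{z̄})` at `z`. -/
def gradNorm {n : ℕ} (f : Cn n → ℂ) (z : Cn n) : ℝ :=
  Real.sqrt (∑ k, ‖wirtinger f k z‖ ^ 2 + ∑ k, ‖wirtingerBar f k z‖ ^ 2)

/-- `f` is a solution of `Δ f = lam f` in the unit ball: twice continuously
differentiable in the real sense, with the equation holding at every point. Here `Δ` is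
the Laplacian of the real inner product space `ℂⁿ`, that is
`∑ (∂²/∂x_k² + ∂²/∂y_k²)`. -/
structure IsSolution {n : ℕ} (lam : ℝ) (f : Cn n → ℂ) : Prop where
  contDiffOn : ContDiffOn ℝ 2 f (unitBall n)
  laplacian_eq : ∀ z ∈ unitBall n, Laplacian.laplacian f z = (lam : ℂ) * f z

/-- The normalized (total mass one) surface measure on the unit sphere of `ℂⁿ`. -/
def sphereMeasure (n : ℕ) : Measure (Metric.sphere (0 : Cn n) 1) :=
  ((volume : Measure (Cn n)).toSphere univ)⁻¹ • (volume : Measure (Cn n)).toSphere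

/-- The integral mean `M_p(r, g) = (∫ |g(rζ)|^p dσ(ζ))^{1/p}` over the unit sphere. -/
def integralMean {n : ℕ} {F : Type*} [Norm F] (p r : ℝ) (g : Cn n → F) : ℝ :=
  (∫ ζ : Metric.sphere (0 : Cn n) 1, ‖g (r • (ζ : Cn n))‖ ^ p ∂(sphereMeasure n)) ^ (1 / p)

/-- A majorant: a continuous increasing function `ω : [0, ∞) → [0, ∞)` with `ω(0) = 0` such
that `ω(t)/t` is non-increasing for `t > 0`. Only the values of `ω` on `[0, ∞)` matter. -/
structure IsMajorant (ω : ℝ → ℝ) : Prop where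
  continuousOn : ContinuousOn ω (Ici 0)
  monotoneOn : MonotoneOn ω (Ici 0)
  nonneg : ∀ t, 0 ≤ t → 0 ≤ ω t
  map_zero : ω 0 = 0
  antitoneOn_div : AntitoneOn (fun t => ω t / t) (Ioi 0)

/-- `T(r) = ∫₀¹ ω(1 / (1 - ρ r)) dρ`. -/
def T (ω : ℝ → ℝ) (r : ℝ) : ℝ :=
  ∫ ρ in (0 : ℝ)..1, ω (1 / (1 - ρ * r))

end Yukawa

end

/-!
The idea is to follow the spherical mean `Φ(s)` of `u = (|f|² + ε)^{p/2}`, a `C²` substitute for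
`|f|^p`, and to let `ε` tend to `0` at the end. Since `p ≥ 2`, a direct computation gives
`0 ≤ Δ u ≤ p λ u + 2 p (p - 1) (|f|² + ε)^{p/2 - 1} |∇̃ f|²`
(`sum_fderiv_fderiv_regPow_nonneg`, `sum_fderiv_fderiv_regPow_le`, `gradNorm_sq`).

The function `Φ` solves the radial equation `Φ'' + (2n - 1) s⁻¹ Φ' = L`, where `L` is the spherical
mean of `Δ u` (`integral_radial_laplacian`). Instead of the divergence theorem on balls, this uses
that `|x|² Δ` is a radial operator plus the sum of the squares of the generators of the plane
rotations, each of which has zero integral over the sphere because the surface measure is invariant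
under rotations (`integral_fderiv_skewAdjoint`). In particular `Φ` is increasing
(`radial_monotoneOn`).

Hölder's inequality (`integral_rpow_mul_sq_le`), the monotonicity of `Φ`, the hypothesis on the
gradient and `ω(t) ≤ ω(1) t` for `t ≥ 1` give, for `s < r`,
`L(s) ≤ p λ Φ(r) + 2 p (p - 1) Φ(r)^{1 - 2/p} C² ω(1) ω(1/(1-s)) / (1 - s)`.
Integrating the radial equation (`radial_comparison`), the first term contributes at most
`p λ Φ(r) / (4n)`, and the weight `1 / (1 - s)` in the second one is absorbed by the kernel, which
leaves `∫₀ʳ ω(1/(1-s)) ds ≤ T(r)`. Finally `Φ(0) ≤ Φ(0)^{2/p} Φ(r)^{1 - 2/p}`, and division by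
`Φ(r)^{1 - 2/p}` yields the estimate for `Φ(r)^{2/p}`.
-/

namespace Yukawa

open Metric
open scoped Pointwise

/-! ### Integrals over the unit sphere and rotations -/

theorem hasDerivAt_integral_of_compactSpace {X : Type*} [TopologicalSpace X] [CompactSpace X]
    [MeasurableSpace X] [OpensMeasurableSpace X] (μ : Measure X) [IsFiniteMeasure μ]
    {F F' : ℝ → X → ℝ} (hF : ∀ t, Continuous (F t))
    (hF' : Continuous (fun q : ℝ × X => F' q.1 q.2))
    (h : ∀ t x, HasDerivAt (fun s => F s x) (F' t x) t) (t : ℝ) :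
    HasDerivAt (fun s => ∫ x, F s x ∂μ) (∫ x, F' t x ∂μ) t := by
  have hc : IsCompact (closedBall t 1 ×ˢ (univ : Set X)) :=
    (isCompact_closedBall t 1).prod isCompact_univ
  obtain ⟨K, hK⟩ := hc.exists_bound_of_continuousOn hF'.continuousOn
  have hint : ∀ g : X → ℝ, Continuous g → Integrable g μ := fun g hg =>
    hg.integrable_of_hasCompactSupport (HasCompactSupport.of_compactSpace g)
  refine (hasDerivAt_integral_of_dominated_loc_of_deriv_le (bound := fun _ => K)
    (closedBall_mem_nhds t one_pos) (Filter.Eventually.of_forall fun s =>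
      (hint _ (hF s)).aestronglyMeasurable) (hint _ (hF t))
    (hint _ (hF'.comp (Continuous.prodMk_right t))).aestronglyMeasurable
    (Filter.Eventually.of_forall fun x s hs => hK (s, x) ⟨hs, mem_univ _⟩)
    (integrable_const K) (Filter.Eventually.of_forall fun x s _ => h s x)).2

section Sphere

variable {E : Type*} [NormedAddCommGroup E] [InnerProductSpace ℝ E]

/-- The action of a linear isometry on the unit sphere. -/
def sphereEquiv (R : E ≃ₗᵢ[ℝ] E) : sphere (0 : E) 1 ≃ₜ sphere (0 : E) 1 where
  toFun x := ⟨R x, by simp⟩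
  invFun x := ⟨R.symm x, by simp⟩
  left_inv x := by simp
  right_inv x := by simp
  continuous_toFun := by fun_prop
  continuous_invFun := by fun_prop

variable [MeasurableSpace E]

/-- Invariance of a measure on the unit sphere under all linear isometries, in the form in which
it is used: for integrals of restrictions of functions on the ambient space. -/
def RotationInvariant (σ : Measure (sphere (0 : E) 1)) : Prop :=
  ∀ (R : E ≃ₗᵢ[ℝ] E) (g : E → ℝ), ∫ ζ, g (R (ζ : E)) ∂σ = ∫ ζ, g (ζ : E) ∂σ

variable [BorelSpace E] [FiniteDimensional ℝ E]

theorem measurePreserving_sphereEquiv (R : E ≃ₗᵢ[ℝ] E) :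
    MeasurePreserving (sphereEquiv R) (volume : Measure E).toSphere
      (volume : Measure E).toSphere := by
  refine ⟨(sphereEquiv R).continuous.measurable, ?_⟩
  ext s hs
  have hm := (sphereEquiv R).continuous.measurable hs
  rw [Measure.map_apply (sphereEquiv R).continuous.measurable hs,
    Measure.toSphere_apply' _ hm, Measure.toSphere_apply' _ hs]
  congr 1
  have h1 : Ioo (0 : ℝ) 1 • ((↑) '' (sphereEquiv R ⁻¹' s) : Set E) =
      R ⁻¹' (Ioo (0 : ℝ) 1 • ((↑) '' s : Set E)) := by
    ext x
    simp only [Set.mem_smul, mem_preimage, mem_image]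
    constructor
    · rintro ⟨c, hc, _, ⟨y, hy, rfl⟩, rfl⟩
      exact ⟨c, hc, _, ⟨_, hy, rfl⟩, by simp [sphereEquiv]⟩
    · rintro ⟨c, hc, _, ⟨y, hy, rfl⟩, h⟩
      refine ⟨c, hc, _, ⟨(sphereEquiv R).symm y, by simpa using hy, rfl⟩, ?_⟩
      apply R.injective
      rw [← h]
      simp [sphereEquiv]
  rw [h1]
  exact R.measurePreserving.measure_preimage_equiv (f := R.toHomeomorph.toMeasurableEquiv) _

theorem rotationInvariant_smul_toSphere (c : ENNReal) :
    RotationInvariant (c • (volume : Measure E).toSphere) := by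
  intro R g
  rw [integral_smul_measure, integral_smul_measure]
  congr 1
  exact (measurePreserving_sphereEquiv R).integral_comp
    (sphereEquiv R).measurableEmbedding (fun ζ => g (ζ : E))

/-- The derivative of `g` along the vector field `x ↦ A x`, with `A` skew-adjoint, has zero integral
over the sphere: the flow `exp (t A)` of this field consists of rotations, so `∫ g (exp (t A) ζ)`
does not depend on `t`. -/
theorem integral_fderiv_skewAdjoint {σ : Measure (sphere (0 : E) 1)} [IsFiniteMeasure σ]
    (hσ : RotationInvariant σ) {g : E → ℝ} (hg : ContDiff ℝ 1 g) {A : E →L[ℝ] E}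
    (hA : A ∈ skewAdjoint (E →L[ℝ] E)) :
    ∫ ζ, fderiv ℝ g (ζ : E) (A ζ) ∂σ = 0 := by
  let U : ℝ → E →L[ℝ] E := fun t => NormedSpace.exp (t • A)
  have hU : ∀ t, HasDerivAt U (U t * A) t := fun t => hasDerivAt_exp_smul_const A t
  have hUc : Continuous U := continuous_iff_continuousAt.2 fun t => (hU t).continuousAt
  let _ : NormedAlgebra ℚ (E →L[ℝ] E) := NormedAlgebra.restrictScalars ℚ ℝ _
  have hun : ∀ t, U t ∈ unitary (E →L[ℝ] E) := fun t => by
    refine NormedSpace.exp_mem_unitary_of_mem_skewAdjoint ?_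
    rw [skewAdjoint.mem_iff] at hA ⊢
    rw [star_smul, hA, star_trivial, smul_neg]
  have hd := hasDerivAt_integral_of_compactSpace σ (F := fun t ζ => g (U t (ζ : E)))
    (F' := fun t ζ => fderiv ℝ g (U t (ζ : E)) ((U t * A) (ζ : E)))
    (fun t => hg.continuous.comp (by fun_prop))
    (((hg.continuous_fderiv one_ne_zero).comp (by fun_prop)).clm_apply (by fun_prop))
    (fun t ζ => by
      have h1 : HasDerivAt (fun s => U s (ζ : E)) ((U t * A) (ζ : E)) t := by
        simpa using (hU t).clm_apply (hasDerivAt_const t (ζ : E))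
      exact ((hg.differentiable one_ne_zero _).hasFDerivAt).comp_hasDerivAt t h1) 0
  have hconst : (fun t => ∫ ζ, g (U t (ζ : E)) ∂σ) = fun _ => ∫ ζ, g (ζ : E) ∂σ := by
    ext t
    exact hσ (Unitary.linearIsometryEquiv ⟨U t, hun t⟩) g
  rw [hconst] at hd
  have := hd.unique (hasDerivAt_const _ _)
  simpa [U] using this

end Sphere

/-! ### Spherical means and the radial Laplacian -/

section SphereMean

variable {E : Type*} [NormedAddCommGroup E] [InnerProductSpace ℝ E]

/-- The generator `x ↦ ⟨a, x⟩ b - ⟨b, x⟩ a` of the rotations in the plane spanned by `a`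
and `b`. -/
noncomputable def rotGen (a b : E) : E →L[ℝ] E :=
  (innerSL ℝ a).smulRight b - (innerSL ℝ b).smulRight a

theorem rotGen_apply (a b x : E) : rotGen a b x = inner ℝ a x • b - inner ℝ b x • a := by
  simp [rotGen]

theorem rotGen_mem_skewAdjoint [CompleteSpace E] (a b : E) :
    rotGen a b ∈ skewAdjoint (E →L[ℝ] E) := by
  rw [skewAdjoint.mem_iff, ContinuousLinearMap.star_eq_adjoint, eq_comm,
    ContinuousLinearMap.eq_adjoint_iff]
  intro x y
  simp only [_root_.neg_apply, rotGen_apply, inner_neg_left, inner_sub_left,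
    inner_sub_right, inner_smul_left, inner_smul_right, real_inner_comm, conj_trivial]
  rw [real_inner_comm x a, real_inner_comm x b]
  ring

variable {ι : Type*} [Fintype ι] (b : OrthonormalBasis ι ℝ E)

/-- Second-order part of the sum of the squares of all the fields `rotGen (b i) (b j)`. The sum is
over ordered pairs, so that each plane counts twice. -/
theorem sum_bilinear_rotGen (B : E →L[ℝ] E →L[ℝ] ℝ) (x : E) :
    ∑ i, ∑ j, B (rotGen (b i) (b j) x) (rotGen (b i) (b j) x) =
      2 * (‖x‖ ^ 2 * ∑ i, B (b i) (b i) - B x x) := by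
  have hx : B x x = ∑ i, ∑ j, inner ℝ (b i) x * inner ℝ (b j) x * B (b i) (b j) := by
    conv_lhs => rw [← b.sum_repr' x]
    simp [map_sum, Finset.mul_sum, mul_assoc]
    rw [Finset.sum_comm]
    refine Finset.sum_congr rfl fun i _ => Finset.sum_congr rfl fun j _ => by ring
  have hn : ‖x‖ ^ 2 = ∑ i, inner ℝ (b i) x ^ 2 := by
    rw [← b.sum_sq_norm_inner_right x]
    simp
  have hx' : B x x = ∑ i, ∑ j, inner ℝ (b i) x * inner ℝ (b j) x * B (b j) (b i) := by
    rw [hx, Finset.sum_comm]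
    refine Finset.sum_congr rfl fun i _ => Finset.sum_congr rfl fun j _ => by ring
  have h1 : ∑ i, ∑ j, inner ℝ (b i) x ^ 2 * B (b j) (b j) = ‖x‖ ^ 2 * ∑ i, B (b i) (b i) := by
    rw [hn, Finset.sum_mul_sum]
  have h2 : ∑ i, ∑ j, inner ℝ (b j) x ^ 2 * B (b i) (b i) = ‖x‖ ^ 2 * ∑ i, B (b i) (b i) := by
    rw [Finset.sum_comm, h1]
  calc _ = ∑ i, ∑ j, (inner ℝ (b i) x ^ 2 * B (b j) (b j)
        - inner ℝ (b i) x * inner ℝ (b j) x * B (b j) (b i)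
        - inner ℝ (b i) x * inner ℝ (b j) x * B (b i) (b j)
        + inner ℝ (b j) x ^ 2 * B (b i) (b i)) := by
        refine Finset.sum_congr rfl fun i _ => Finset.sum_congr rfl fun j _ => ?_
        simp only [rotGen_apply, map_sub, map_smul, _root_.sub_apply,
          _root_.smul_apply, smul_eq_mul]
        ring
    _ = _ := by
        simp only [Finset.sum_add_distrib, Finset.sum_sub_distrib]
        rw [h1, h2, ← hx, ← hx']
        ring

/-- First-order part of the sum of the squares of all the fields `rotGen (b i) (b j)`. -/
theorem sum_rotGen_rotGen (x : E) :
    ∑ i, ∑ j, rotGen (b i) (b j) (rotGen (b i) (b j) x) =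
      -(2 * ((Fintype.card ι : ℝ) - 1)) • x := by
  classical
  have hx : ∑ i, inner ℝ (b i) x • b i = x := b.sum_repr' x
  calc _ = ∑ i, ∑ j, ((if i = j then inner ℝ (b i) x • b j else 0)
        + (if i = j then inner ℝ (b j) x • b i else 0)
        - inner ℝ (b j) x • b j - inner ℝ (b i) x • b i) := by
        refine Finset.sum_congr rfl fun i _ => Finset.sum_congr rfl fun j _ => ?_
        simp only [rotGen_apply, inner_sub_right, inner_smul_right, 
          orthonormal_iff_ite.1 b.orthonormal]
        by_cases h : i = j
        · subst h; simp
        · simp [h, Ne.symm h]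
    _ = _ := by
        simp only [Finset.sum_add_distrib, Finset.sum_sub_distrib, Finset.sum_ite_eq,
          Finset.mem_univ, if_true, hx, Finset.sum_const, Finset.card_univ, ← Finset.smul_sum]
        simp only [← Nat.cast_smul_eq_nsmul ℝ]
        module

variable [MeasurableSpace E] [BorelSpace E] [FiniteDimensional ℝ E]

/-- The spherical mean of `u` over the sphere of radius `r`, with respect to a measure `σ` on the
unit sphere that need not be normalized. -/
noncomputable def sphereMean (σ : Measure (sphere (0 : E) 1)) (u : E → ℝ) (r : ℝ) : ℝ :=
  ∫ ζ, u (r • (ζ : E)) ∂σ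

theorem integrable_of_continuous_sphere {σ : Measure (sphere (0 : E) 1)} [IsFiniteMeasure σ]
    {g : sphere (0 : E) 1 → ℝ} (hg : Continuous g) : Integrable g σ :=
  hg.integrable_of_hasCompactSupport (HasCompactSupport.of_compactSpace g)

variable {σ : Measure (sphere (0 : E) 1)} [IsFiniteMeasure σ] {u : E → ℝ}

theorem hasDerivAt_sphereMean (hu : ContDiff ℝ 1 u) (r : ℝ) :
    HasDerivAt (sphereMean σ u) (∫ ζ, fderiv ℝ u (r • (ζ : E)) (ζ : E) ∂σ) r := by
  refine hasDerivAt_integral_of_compactSpace σ (F := fun r ζ => u (r • (ζ : E)))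
    (F' := fun r ζ => fderiv ℝ u (r • (ζ : E)) (ζ : E))
    (fun t => hu.continuous.comp (by fun_prop))
    (((hu.continuous_fderiv one_ne_zero).comp (by fun_prop)).clm_apply (by fun_prop)) ?_ r
  intro t ζ
  have h1 : HasDerivAt (fun s : ℝ => s • (ζ : E)) (ζ : E) t := by
    simpa using (hasDerivAt_id t).smul_const (ζ : E)
  exact ((hu.differentiable one_ne_zero _).hasFDerivAt).comp_hasDerivAt t h1

theorem hasDerivAt_integral_fderiv_radial (hu : ContDiff ℝ 2 u) (r : ℝ) :
    HasDerivAt (fun r => ∫ ζ, fderiv ℝ u (r • (ζ : E)) (ζ : E) ∂σ)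
      (∫ ζ, fderiv ℝ (fderiv ℝ u) (r • (ζ : E)) (ζ : E) (ζ : E) ∂σ) r := by
  have hu1 : ContDiff ℝ 1 (fderiv ℝ u) := hu.fderiv_right (by norm_num)
  refine hasDerivAt_integral_of_compactSpace σ
    (F := fun r ζ => fderiv ℝ u (r • (ζ : E)) (ζ : E))
    (F' := fun r ζ => fderiv ℝ (fderiv ℝ u) (r • (ζ : E)) (ζ : E) (ζ : E))
    (fun t => (hu1.continuous.comp (by fun_prop)).clm_apply (by fun_prop))
    ((((hu1.continuous_fderiv one_ne_zero).comp (by fun_prop)).clm_apply (by fun_prop)).clm_apply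
      (by fun_prop)) ?_ r
  intro t ζ
  have h1 : HasDerivAt (fun s : ℝ => s • (ζ : E)) (ζ : E) t := by
    simpa using (hasDerivAt_id t).smul_const (ζ : E)
  have h2 := ((hu1.differentiable one_ne_zero _).hasFDerivAt).comp_hasDerivAt t h1
  simpa using h2.clm_apply (hasDerivAt_const t (ζ : E))

/-- The spherical mean `Φ` of `u` satisfies `r Φ'' + (N - 1) Φ' = r Ψ`, where `Ψ` is the spherical
mean of the Laplacian and `N` the dimension. The Laplacian differs from the radial operator
`∂_r² + (N - 1) r⁻¹ ∂_r` by a sum of squares of rotation fields, and these integrate to zero. -/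
theorem integral_radial_laplacian (hσ : RotationInvariant σ) (hu : ContDiff ℝ 2 u) (r : ℝ) :
    r * ∫ ζ, fderiv ℝ (fderiv ℝ u) (r • (ζ : E)) (ζ : E) (ζ : E) ∂σ
      + ((Fintype.card ι : ℝ) - 1) * ∫ ζ, fderiv ℝ u (r • (ζ : E)) (ζ : E) ∂σ
      = r * ∫ ζ, ∑ i, fderiv ℝ (fderiv ℝ u) (r • (ζ : E)) (b i) (b i) ∂σ := by
  have hu1 : ContDiff ℝ 1 (fderiv ℝ u) := hu.fderiv_right (by norm_num)
  have hc1 : Continuous fun ζ : sphere (0 : E) 1 => fderiv ℝ u (r • (ζ : E)) :=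
    hu1.continuous.comp (by fun_prop)
  have hc2 : Continuous fun ζ : sphere (0 : E) 1 => fderiv ℝ (fderiv ℝ u) (r • (ζ : E)) :=
    (hu1.continuous_fderiv one_ne_zero).comp (by fun_prop)
  -- The rotation field of `(b i, b j)`, applied twice to `x ↦ u (r x)`, up to a factor `r`.
  have key : ∀ i j, ∫ ζ, (r * fderiv ℝ (fderiv ℝ u) (r • (ζ : E))
        (rotGen (b i) (b j) (ζ : E)) (rotGen (b i) (b j) (ζ : E))
      + fderiv ℝ u (r • (ζ : E)) (rotGen (b i) (b j) (rotGen (b i) (b j) (ζ : E)))) ∂σ = 0 := by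
    intro i j
    set A := rotGen (b i) (b j)
    have hg : ContDiff ℝ 1 fun x : E => fderiv ℝ u (r • x) (A x) :=
      (hu1.comp (contDiff_const_smul r)).clm_apply A.contDiff
    rw [← integral_fderiv_skewAdjoint hσ hg (rotGen_mem_skewAdjoint (b i) (b j))]
    congr 1
    ext ζ
    have h1 : HasFDerivAt (fun x : E => r • x) (r • ContinuousLinearMap.id ℝ E) (ζ : E) :=
      (hasFDerivAt_id _).const_smul r
    have h2 := ((hu1.differentiable one_ne_zero (r • (ζ : E))).hasFDerivAt).comp (ζ : E) h1
    have h3 := h2.clm_apply (A.hasFDerivAt (x := (ζ : E)))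
    have h4 : fderiv ℝ (fun x : E => fderiv ℝ u (r • x) (A x)) (ζ : E) = _ := h3.fderiv
    rw [h4]
    simp [A]
    ring
  have hsum : ∫ ζ, (∑ i, ∑ j, (r * fderiv ℝ (fderiv ℝ u) (r • (ζ : E))
        (rotGen (b i) (b j) (ζ : E)) (rotGen (b i) (b j) (ζ : E))
      + fderiv ℝ u (r • (ζ : E)) (rotGen (b i) (b j) (rotGen (b i) (b j) (ζ : E))))) ∂σ = 0 := by
    have hcont : ∀ i j, Continuous fun ζ : sphere (0 : E) 1 =>
        (r * fderiv ℝ (fderiv ℝ u) (r • (ζ : E))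
        (rotGen (b i) (b j) (ζ : E)) (rotGen (b i) (b j) (ζ : E))
      + fderiv ℝ u (r • (ζ : E)) (rotGen (b i) (b j) (rotGen (b i) (b j) (ζ : E)))) := by
      intro i j
      fun_prop
    rw [integral_finsetSum _ fun i _ => integrable_of_continuous_sphere
      (continuous_finsetSum _ fun j _ => hcont i j)]
    refine Finset.sum_eq_zero fun i _ => ?_
    rw [integral_finsetSum _ fun j _ => integrable_of_continuous_sphere (hcont i j)]
    exact Finset.sum_eq_zero fun j _ => key i j
  have hpt : ∀ ζ : sphere (0 : E) 1, (∑ i, ∑ j, (r * fderiv ℝ (fderiv ℝ u) (r • (ζ : E))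
        (rotGen (b i) (b j) (ζ : E)) (rotGen (b i) (b j) (ζ : E))
      + fderiv ℝ u (r • (ζ : E)) (rotGen (b i) (b j) (rotGen (b i) (b j) (ζ : E))))) =
      2 * (r * (∑ i, fderiv ℝ (fderiv ℝ u) (r • (ζ : E)) (b i) (b i))
        - r * fderiv ℝ (fderiv ℝ u) (r • (ζ : E)) (ζ : E) (ζ : E)
        - ((Fintype.card ι : ℝ) - 1) * fderiv ℝ u (r • (ζ : E)) (ζ : E)) := by
    intro ζ
    simp only [Finset.sum_add_distrib, ← Finset.mul_sum, ← map_sum]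
    rw [sum_bilinear_rotGen, sum_rotGen_rotGen, map_smul, norm_eq_of_mem_sphere]
    simp only [smul_eq_mul]
    ring
  simp only [hpt] at hsum
  rw [integral_const_mul, integral_sub, integral_sub, integral_const_mul, integral_const_mul,
    integral_const_mul] at hsum
  · linarith
  all_goals exact integrable_of_continuous_sphere (by fun_prop)

end SphereMean

/-! ### A comparison principle for the radial equation -/

section RadialODE

variable {m : ℕ} {Φ Φ' Φ'' L : ℝ → ℝ} {r : ℝ}

/-- Divergence form of the radial equation in dimension `m + 2`. -/
theorem hasDerivAt_pow_mul_radial (h1 : ∀ s, HasDerivAt Φ' (Φ'' s) s)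
    (hode : ∀ s, s * Φ'' s + (m + 1) * Φ' s = s * L s) (s : ℝ) :
    HasDerivAt (fun s => s ^ (m + 1) * Φ' s) (s ^ (m + 1) * L s) s := by
  convert! (hasDerivAt_pow (m + 1) s).mul (h1 s) using 1
  have := hode s
  push_cast
  simp only [pow_succ]
  linear_combination -(s ^ m) * this

/-- Spherical means of subharmonic functions are increasing. -/
theorem radial_monotoneOn (h0 : ∀ s, HasDerivAt Φ (Φ' s) s) (h1 : ∀ s, HasDerivAt Φ' (Φ'' s) s)
    (hode : ∀ s, s * Φ'' s + (m + 1) * Φ' s = s * L s) (hL : ∀ s ∈ Ioo 0 r, 0 ≤ L s) :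
    MonotoneOn Φ (Icc 0 r) := by
  have hH : MonotoneOn (fun s => s ^ (m + 1) * Φ' s) (Icc 0 r) := by
    refine monotoneOn_of_hasDerivWithinAt_nonneg (convex_Icc 0 r)
      (fun s _ => (hasDerivAt_pow_mul_radial h1 hode s).continuousAt.continuousWithinAt)
      (fun s _ => (hasDerivAt_pow_mul_radial h1 hode s).hasDerivWithinAt) ?_
    intro s hs
    rw [interior_Icc] at hs
    exact mul_nonneg (pow_nonneg hs.1.le _) (hL s hs)
  refine monotoneOn_of_hasDerivWithinAt_nonneg (convex_Icc 0 r)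
    (fun s _ => (h0 s).continuousAt.continuousWithinAt) (fun s _ => (h0 s).hasDerivWithinAt) ?_
  intro s hs
  rw [interior_Icc] at hs
  have := hH ⟨le_rfl, (hs.1.trans hs.2).le⟩ ⟨hs.1.le, hs.2.le⟩ hs.1.le
  simp only [ne_eq, Nat.add_eq_zero_iff, one_ne_zero, and_false, not_false_eq_true, zero_pow,
    zero_mul] at this
  exact (mul_nonneg_iff_of_pos_left (pow_pos hs.1 _)).1 this

/-- If `Φ` solves the radial equation in dimension `m + 2` with right-hand side at most `A + B q`,
then the contribution of `A` to `Φ r` is `A r² / (2 (m + 2))` and the one of `q` is bounded by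
`∫ (1 - s) q`. The kernel `1 - s` is what remains of the Green function: replacing the weight
`t ^ (m + 1)` in `∫₀ˢ t ^ (m + 1) q` by its maximum `s ^ (m + 1)` bounds `Φ'` by `∫₀ˢ q`, and a second
integration produces `∫ (r - s) q ≤ ∫ (1 - s) q`. -/
theorem radial_comparison (h0 : ∀ s, HasDerivAt Φ (Φ' s) s)
    (h1 : ∀ s, HasDerivAt Φ' (Φ'' s) s)
    (hode : ∀ s, s * Φ'' s + (m + 1) * Φ' s = s * L s) {A B : ℝ} (hB : 0 ≤ B) {q : ℝ → ℝ}
    (hq : Continuous q) (hq0 : ∀ s, 0 ≤ q s) (hL : ∀ s ∈ Ioo 0 r, L s ≤ A + B * q s)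
    (hr : 0 ≤ r) (hr1 : r ≤ 1) :
    Φ r ≤ Φ 0 + A * r ^ 2 / (2 * (m + 2)) + B * ∫ s in (0 : ℝ)..r, (1 - s) * q s := by
  have hm : (0 : ℝ) < m + 2 := by positivity
  set Q : ℝ → ℝ := fun s => ∫ t in (0 : ℝ)..s, q t
  have hQ : ∀ s, HasDerivAt Q (q s) s := fun s => hq.integral_hasStrictDerivAt 0 s |>.hasDerivAt
  have hQ0 : ∀ s, 0 ≤ s → 0 ≤ Q s := fun s hs =>
    intervalIntegral.integral_nonneg hs fun t _ => hq0 t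
  set V : ℝ → ℝ := fun s => ∫ t in (0 : ℝ)..s, (1 - t) * q t
  have hV : ∀ s, HasDerivAt V ((1 - s) * q s) s := fun s =>
    (Continuous.integral_hasStrictDerivAt (by fun_prop) 0 s).hasDerivAt
  -- Comparison of the two sides after multiplication by `s ^ (m + 1)`, where both vanish at `0`.
  have hΦ' : ∀ s ∈ Ioo 0 r, Φ' s ≤ A * s / (m + 2) + B * Q s := by
    have hd : ∀ s, HasDerivAt
        (fun s => s ^ (m + 1) * Φ' s - (A / (m + 2) * s ^ (m + 2) + B * (s ^ (m + 1) * Q s)))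
        (s ^ (m + 1) * (L s - (A + B * q s)) - B * (((m + 1 : ℕ) * s ^ m) * Q s)) s := by
      intro s
      convert! (hasDerivAt_pow_mul_radial h1 hode s).sub
        (((hasDerivAt_pow (m + 2) s).const_mul (A / (m + 2))).add
          (((hasDerivAt_pow (m + 1) s).mul (hQ s)).const_mul B)) using 1
      simp only [Nat.add_sub_cancel]
      have : m + 2 - 1 = m + 1 := rfl
      rw [this]
      push_cast
      field_simp
      ring
    have hH := antitoneOn_of_hasDerivWithinAt_nonpos (convex_Icc 0 r)
      (fun s _ => (hd s).continuousAt.continuousWithinAt)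
      (fun s _ => (hd s).hasDerivWithinAt) (fun s hs => by
        rw [interior_Icc] at hs
        have e1 := mul_nonneg (pow_nonneg hs.1.le (m + 1)) (sub_nonneg.2 (hL s hs))
        have e2 : 0 ≤ B * (((m + 1 : ℕ) * s ^ m) * Q s) := by
          have := hQ0 s hs.1.le
          have := hs.1.le
          positivity
        linarith)
    intro s hs
    have := hH ⟨le_rfl, (hs.1.trans hs.2).le⟩ ⟨hs.1.le, hs.2.le⟩ hs.1.le
    simp only [ne_eq, Nat.add_eq_zero_iff, one_ne_zero, and_false, not_false_eq_true, zero_pow,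
      zero_mul, OfNat.ofNat_ne_zero, mul_zero, add_zero, sub_zero] at this
    have e : s ^ (m + 1) * (Φ' s - (A * s / (m + 2) + B * Q s)) ≤ 0 := by
      refine le_of_eq_of_le ?_ this
      ring
    have := (mul_nonpos_iff_pos_imp_nonpos.1 e).1 (pow_pos hs.1 _)
    linarith
  -- `V - (1 - s) Q` is a primitive of `Q`.
  have hd : ∀ s, HasDerivAt
      (fun s => Φ s - (A / (2 * (m + 2)) * s ^ 2 + B * (V s - (1 - s) * Q s)))
      (Φ' s - (A * s / (m + 2) + B * Q s)) s := by
    intro s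
    convert! (h0 s).sub (((hasDerivAt_pow 2 s).const_mul (A / (2 * (m + 2)))).add
      (((hV s).sub (((hasDerivAt_id s).const_sub 1).mul (hQ s))).const_mul B)) using 1
    push_cast
    simp only [id]
    field_simp
    ring
  have hH := antitoneOn_of_hasDerivWithinAt_nonpos (convex_Icc 0 r)
    (fun s _ => (hd s).continuousAt.continuousWithinAt)
    (fun s _ => (hd s).hasDerivWithinAt) (fun s hs => by
      rw [interior_Icc] at hs
      linarith [hΦ' s hs])
  have := hH ⟨le_rfl, hr⟩ ⟨hr, le_rfl⟩ hr
  simp only [Q, V, intervalIntegral.integral_same] at this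
  have e := mul_nonneg hB (mul_nonneg (sub_nonneg.2 hr1) (hQ0 r hr))
  have e2 : A / (2 * (m + 2)) * r ^ 2 = A * r ^ 2 / (2 * (m + 2)) := by ring
  simp only [Q] at e
  linarith

end RadialODE

/-! ### The Laplacian of the regularized power of the norm -/

section Pointwise

variable {E F : Type*} [NormedAddCommGroup E] [InnerProductSpace ℝ E]
  [NormedAddCommGroup F] [InnerProductSpace ℝ F]

/-- The regularization `(‖f‖² + ε)^{p/2}` of `‖f‖ ^ p`; for `ε > 0` it is positive and as smooth
as `f` is. -/
noncomputable def regPow (p ε : ℝ) (f : E → F) (x : E) : ℝ := (‖f x‖ ^ 2 + ε) ^ (p / 2)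

variable {f : E → F} {p ε : ℝ}

theorem contDiff_regPow (hf : ContDiff ℝ 2 f) (hε : 0 < ε) : ContDiff ℝ 2 (regPow p ε f) :=
  ((hf.norm_sq ℝ).add contDiff_const).rpow_const_of_ne fun x => by positivity

theorem fderiv_regPow (hf : ContDiff ℝ 2 f) (hε : 0 < ε) (x e : E) :
    fderiv ℝ (regPow p ε f) x e =
      p * (‖f x‖ ^ 2 + ε) ^ (p / 2 - 1) * inner ℝ (f x) (fderiv ℝ f x e) := by
  have h1 := (hf.differentiable two_ne_zero x).hasFDerivAt
  have h2 := ((h1.norm_sq).add_const ε).rpow_const (p := p / 2) (Or.inl (by positivity))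
  have h3 : fderiv ℝ (regPow p ε f) x = _ := h2.fderiv
  rw [h3]
  simp
  ring

theorem fderiv_fderiv_regPow (hf : ContDiff ℝ 2 f) (hε : 0 < ε) (x e : E) :
    fderiv ℝ (fderiv ℝ (regPow p ε f)) x e e =
      p * (p - 2) * (‖f x‖ ^ 2 + ε) ^ (p / 2 - 2) * inner ℝ (f x) (fderiv ℝ f x e) ^ 2
      + p * (‖f x‖ ^ 2 + ε) ^ (p / 2 - 1) *
        (‖fderiv ℝ f x e‖ ^ 2 + inner ℝ (f x) (fderiv ℝ (fderiv ℝ f) x e e)) := by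
  have hf1 : ContDiff ℝ 1 (fderiv ℝ f) := hf.fderiv_right (by norm_num)
  have hu1 : ContDiff ℝ 1 (fderiv ℝ (regPow p ε f)) :=
    (contDiff_regPow hf hε).fderiv_right (by norm_num)
  have h1 := (hf.differentiable two_ne_zero x).hasFDerivAt
  have h2 := ((h1.norm_sq).add_const ε).rpow_const (p := p / 2 - 1) (Or.inl (by positivity))
  have h3 := ((hf1.differentiable one_ne_zero x).hasFDerivAt).clm_apply (hasFDerivAt_const e x)
  have h4 := (h2.const_mul p).mul (h1.inner ℝ h3)
  have h5 := ((hu1.differentiable one_ne_zero x).hasFDerivAt).clm_apply (hasFDerivAt_const e x)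
  have h6 : (fun y => fderiv ℝ (regPow p ε f) y e) = fun y =>
      p * (‖f y‖ ^ 2 + ε) ^ (p / 2 - 1) * inner ℝ (f y) (fderiv ℝ f y e) :=
    funext fun y => fderiv_regPow hf hε y e
  rw [h6] at h5
  have h7 := congrArg (fun T => T e) (h5.unique h4)
  have h8 : p / 2 - 1 - 1 = p / 2 - 2 := by ring
  simp [h8] at h7
  rw [h7]
  ring

variable {ι : Type*} [Fintype ι] {b : ι → E} {lam : ℝ} {x : E}

theorem sum_fderiv_fderiv_regPow (hf : ContDiff ℝ 2 f) (hε : 0 < ε)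
    (hx : ∑ i, fderiv ℝ (fderiv ℝ f) x (b i) (b i) = lam • f x) :
    ∑ i, fderiv ℝ (fderiv ℝ (regPow p ε f)) x (b i) (b i) =
      p * (p - 2) * (‖f x‖ ^ 2 + ε) ^ (p / 2 - 2) *
        ∑ i, inner ℝ (f x) (fderiv ℝ f x (b i)) ^ 2
      + p * (‖f x‖ ^ 2 + ε) ^ (p / 2 - 1) *
        (∑ i, ‖fderiv ℝ f x (b i)‖ ^ 2 + lam * ‖f x‖ ^ 2) := by
  have : lam * ‖f x‖ ^ 2 = ∑ i, inner ℝ (f x) (fderiv ℝ (fderiv ℝ f) x (b i) (b i)) := by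
    rw [← inner_sum, hx, inner_smul_right, real_inner_self_eq_norm_sq]
  rw [this, ← Finset.sum_add_distrib, Finset.mul_sum, Finset.mul_sum, ← Finset.sum_add_distrib]
  exact Finset.sum_congr rfl fun i _ => fderiv_fderiv_regPow hf hε x (b i)

theorem sum_fderiv_fderiv_regPow_nonneg (hf : ContDiff ℝ 2 f) (hε : 0 < ε) (hp : 2 ≤ p)
    (hlam : 0 ≤ lam) (hx : ∑ i, fderiv ℝ (fderiv ℝ f) x (b i) (b i) = lam • f x) :
    0 ≤ ∑ i, fderiv ℝ (fderiv ℝ (regPow p ε f)) x (b i) (b i) := by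
  rw [sum_fderiv_fderiv_regPow hf hε hx]
  have : 0 ≤ p - 2 := by linarith
  positivity

/-- The bound `Δ u ≤ p λ u + p (p - 1) (‖f‖² + ε)^{p/2 - 1} |Df|²` for `u = (‖f‖² + ε)^{p/2}`, from
`⟨f, Df e⟩² ≤ (‖f‖² + ε) ‖Df e‖²`. -/
theorem sum_fderiv_fderiv_regPow_le (hf : ContDiff ℝ 2 f) (hε : 0 < ε) (hp : 2 ≤ p)
    (hlam : 0 ≤ lam) (hx : ∑ i, fderiv ℝ (fderiv ℝ f) x (b i) (b i) = lam • f x) :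
    ∑ i, fderiv ℝ (fderiv ℝ (regPow p ε f)) x (b i) (b i) ≤
      p * lam * regPow p ε f x
      + p * (p - 1) * ((‖f x‖ ^ 2 + ε) ^ (p / 2 - 1) * ∑ i, ‖fderiv ℝ f x (b i)‖ ^ 2) := by
  rw [sum_fderiv_fderiv_regPow hf hε hx, regPow]
  set v := ‖f x‖ ^ 2 + ε
  have hv : 0 < v := by positivity
  have hp2 : 0 ≤ p - 2 := by linarith
  have e1 : v ^ (p / 2 - 1) = v ^ (p / 2 - 2) * v := by
    rw [← Real.rpow_add_one hv.ne']; congr 1; ring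
  have e2 : v ^ (p / 2) = v ^ (p / 2 - 1) * v := by
    rw [← Real.rpow_add_one hv.ne']; congr 1; ring
  have hS : ∑ i, inner ℝ (f x) (fderiv ℝ f x (b i)) ^ 2 ≤
      v * ∑ i, ‖fderiv ℝ f x (b i)‖ ^ 2 := by
    rw [Finset.mul_sum]
    refine Finset.sum_le_sum fun i _ => ?_
    calc inner ℝ (f x) (fderiv ℝ f x (b i)) ^ 2 ≤ (‖f x‖ * ‖fderiv ℝ f x (b i)‖) ^ 2 := by
          refine sq_le_sq' ?_ (real_inner_le_norm _ _)
          exact neg_le_of_abs_le (abs_real_inner_le_norm _ _)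
      _ = ‖f x‖ ^ 2 * ‖fderiv ℝ f x (b i)‖ ^ 2 := by ring
      _ ≤ _ := by gcongr; simp [v, hε.le]
  have k1 : p * (p - 2) * v ^ (p / 2 - 2) * ∑ i, inner ℝ (f x) (fderiv ℝ f x (b i)) ^ 2 ≤
      p * (p - 2) * v ^ (p / 2 - 2) * (v * ∑ i, ‖fderiv ℝ f x (b i)‖ ^ 2) := by
    have : 0 ≤ p * (p - 2) * v ^ (p / 2 - 2) := by positivity
    gcongr
  have k2 : p * v ^ (p / 2 - 1) * (lam * ‖f x‖ ^ 2) ≤ p * v ^ (p / 2 - 1) * (lam * v) := by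
    have : 0 ≤ p * v ^ (p / 2 - 1) := by positivity
    gcongr
    simp [v, hε.le]
  calc _ ≤ p * (p - 2) * v ^ (p / 2 - 2) * (v * ∑ i, ‖fderiv ℝ f x (b i)‖ ^ 2)
        + (p * v ^ (p / 2 - 1) * ∑ i, ‖fderiv ℝ f x (b i)‖ ^ 2
          + p * v ^ (p / 2 - 1) * (lam * v)) := by
        rw [mul_add (p * v ^ (p / 2 - 1))]
        gcongr
    _ = _ := by rw [e2, e1]; ring

end Pointwise

/-! ### Real calculus on `ℂⁿ` and Hölder's inequality -/

theorem rotationInvariant_sphereMeasure (n : ℕ) : RotationInvariant (sphereMeasure n) :=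
  rotationInvariant_smul_toSphere _

theorem isProbabilityMeasure_sphereMeasure {n : ℕ} (hn : 1 ≤ n) :
    IsProbabilityMeasure (sphereMeasure n) := by
  have : Nonempty (Fin n) := ⟨⟨0, hn⟩⟩
  refine ⟨?_⟩
  rw [sphereMeasure, Measure.smul_apply, smul_eq_mul]
  refine ENNReal.inv_mul_cancel ?_ (measure_ne_top _ _)
  rw [ne_eq, Measure.measure_univ_eq_zero]
  exact Measure.toSphere_ne_zero _

/-- The real orthonormal basis of `ℂⁿ` made of the vectors `e_k` and `i e_k`. -/
noncomputable def realBasis (n : ℕ) : OrthonormalBasis (Σ _ : Fin n, Fin 2) ℝ (Cn n) :=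
  Pi.orthonormalBasis fun _ => Complex.orthonormalBasisOneI

theorem realBasis_zero {n : ℕ} (k : Fin n) :
    realBasis n ⟨k, 0⟩ = EuclideanSpace.single k (1 : ℂ) := by
  simp [realBasis, Pi.orthonormalBasis_apply]

theorem realBasis_one {n : ℕ} (k : Fin n) :
    realBasis n ⟨k, 1⟩ = EuclideanSpace.single k Complex.I := by
  simp [realBasis, Pi.orthonormalBasis_apply]

theorem card_realBasis (n : ℕ) : Fintype.card (Σ _ : Fin n, Fin 2) = 2 * n := by
  simp [mul_comm]

theorem laplacian_eq_sum_realBasis {n : ℕ} (f : Cn n → ℂ) (z : Cn n) :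
    Laplacian.laplacian f z =
      ∑ i, fderiv ℝ (fderiv ℝ f) z (realBasis n i) (realBasis n i) := by
  rw [InnerProductSpace.laplacian_eq_iteratedFDeriv_orthonormalBasis f (realBasis n)]
  simp [iteratedFDeriv_two_apply]

/-- With the factor `1/2` in the Wirtinger derivatives, `gradNorm` is `1/√2` times the
Hilbert-Schmidt norm of the real differential. -/
theorem gradNorm_eq {n : ℕ} (f : Cn n → ℂ) (z : Cn n) :
    gradNorm f z = Real.sqrt ((∑ i, ‖fderiv ℝ f z (realBasis n i)‖ ^ 2) / 2) := by
  rw [gradNorm, Fintype.sum_sigma, ← Finset.sum_add_distrib, Finset.sum_div]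
  congr 1
  refine Finset.sum_congr rfl fun k _ => ?_
  rw [Fin.sum_univ_two, realBasis_zero, realBasis_one, wirtinger, wirtingerBar, norm_div, norm_div]
  have h := parallelogram_law_with_norm ℝ (partialX f k z) (Complex.I * partialY f k z)
  rw [norm_mul, Complex.norm_I, one_mul] at h
  simp only [partialX, partialY] at h ⊢
  norm_num
  linarith

theorem gradNorm_sq {n : ℕ} (f : Cn n → ℂ) (z : Cn n) :
    ∑ i, ‖fderiv ℝ f z (realBasis n i)‖ ^ 2 = 2 * gradNorm f z ^ 2 := by
  rw [gradNorm_eq, Real.sq_sqrt (by positivity)]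
  ring

theorem continuous_gradNorm {n : ℕ} {f : Cn n → ℂ} (hf : ContDiff ℝ 1 f) :
    Continuous (gradNorm f) := by
  have h := hf.continuous_fderiv one_ne_zero
  have : gradNorm f = fun z => Real.sqrt ((∑ i, ‖fderiv ℝ f z (realBasis n i)‖ ^ 2) / 2) :=
    funext (gradNorm_eq f)
  rw [this]
  fun_prop

/-- Cutting off outside a smaller ball makes a solution globally `C²`, so that spherical means can
be differentiated on the whole line. -/
theorem exists_contDiff_eqOn_ball {E F : Type*} [NormedAddCommGroup E] [NormedSpace ℝ E]
    [HasContDiffBump E] [NormedAddCommGroup F] [NormedSpace ℝ F] {f : E → F}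
    (hf : ContDiffOn ℝ 2 f (ball 0 1)) {r : ℝ} (h0 : 0 < r) (h1 : r < 1) :
    ∃ g : E → F, ContDiff ℝ 2 g ∧ EqOn g f (closedBall 0 r) := by
  let χ : ContDiffBump (0 : E) := ⟨r, (r + 1) / 2, h0, by linarith⟩
  refine ⟨fun x => χ x • f x, contDiff_iff_contDiffAt.2 fun x => ?_, fun x hx => ?_⟩
  · by_cases hx : x ∈ ball (0 : E) 1
    · exact χ.contDiff.contDiffAt.smul (hf.contDiffAt (isOpen_ball.mem_nhds hx))
    · have hx' : x ∈ (closedBall (0 : E) ((r + 1) / 2))ᶜ := fun h => hx <| by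
        rw [mem_closedBall] at h
        rw [mem_ball]
        linarith
      refine (contDiffAt_const (c := (0 : F))).congr_of_eventuallyEq ?_
      filter_upwards [isClosed_closedBall.isOpen_compl.mem_nhds hx'] with y hy
      rw [χ.zero_of_le_dist (not_le.1 fun h => hy h).le, zero_smul]
  · simp only [χ.one_of_mem_closedBall hx, one_smul]

/-- Hölder's inequality with the exponents `p / (p - 2)` and `p / 2`, including the degenerate
case `p = 2`. -/
theorem integral_rpow_mul_sq_le {X : Type*} [TopologicalSpace X] [CompactSpace X]
    [MeasurableSpace X] [BorelSpace X] {μ : Measure X} [IsFiniteMeasure μ]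
    {v g : X → ℝ} (hv : Continuous v) (hg : Continuous g) (hv0 : ∀ x, 0 < v x)
    (hg0 : ∀ x, 0 ≤ g x) {p : ℝ} (hp : 2 ≤ p) :
    ∫ x, v x ^ (p / 2 - 1) * g x ^ 2 ∂μ ≤
      (∫ x, v x ^ (p / 2) ∂μ) ^ (1 - 2 / p) * ((∫ x, g x ^ p ∂μ) ^ (1 / p)) ^ 2 := by
  have hI : 0 ≤ ∫ x, g x ^ p ∂μ := integral_nonneg fun x => Real.rpow_nonneg (hg0 x) _
  have hpow : ((∫ x, g x ^ p ∂μ) ^ (1 / p)) ^ 2 = (∫ x, g x ^ p ∂μ) ^ (1 / (p / 2)) := by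
    rw [← Real.rpow_natCast, ← Real.rpow_mul hI]
    congr 1
    field_simp
    norm_num
  rw [hpow]
  rcases hp.eq_or_lt with rfl | hp
  · norm_num
  · have hpq : (p / (p - 2)).HolderConjugate (p / 2) := by
      rw [Real.holderConjugate_iff]
      have : 0 < p - 2 := by linarith
      refine ⟨by rw [lt_div_iff₀ this]; linarith, ?_⟩
      field_simp
      ring
    have hmem : ∀ (h : X → ℝ) (s : ENNReal), Continuous h → MemLp h s μ := fun h s hh =>
      hh.memLp_of_hasCompactSupport (HasCompactSupport.of_compactSpace h)
    have hv1 : Continuous fun x => v x ^ (p / 2 - 1) :=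
      hv.rpow_const fun x => Or.inl (hv0 x).ne'
    have hH := integral_mul_le_Lp_mul_Lq_of_nonneg hpq (μ := μ)
      (f := fun x => v x ^ (p / 2 - 1)) (g := fun x => g x ^ 2)
      (Filter.Eventually.of_forall fun x => Real.rpow_nonneg (hv0 x).le _)
      (Filter.Eventually.of_forall fun x => sq_nonneg _) (hmem _ _ hv1) (hmem _ _ (by fun_prop))
    have hp2 : p - 2 ≠ 0 := by linarith
    have e1 : ∀ x, (v x ^ (p / 2 - 1)) ^ (p / (p - 2)) = v x ^ (p / 2) := fun x => by
      rw [← Real.rpow_mul (hv0 x).le]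
      congr 1
      field_simp
    have e2 : ∀ x, (g x ^ 2) ^ (p / 2) = g x ^ p := fun x => by
      rw [← Real.rpow_natCast, ← Real.rpow_mul (hg0 x)]
      congr 1
      push_cast
      ring
    simp only [e1, e2] at hH
    have e3 : 1 / (p / (p - 2)) = 1 - 2 / p := by
      field_simp
    rwa [e3] at hH

/-! ### Majorants -/

namespace IsMajorant

variable {ω : ℝ → ℝ}

theorem le_mul (hω : IsMajorant ω) {t : ℝ} (ht : 1 ≤ t) : ω t ≤ ω 1 * t := by
  have h := hω.antitoneOn_div (mem_Ioi.2 one_pos) (mem_Ioi.2 (by linarith)) ht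
  simp only [div_one] at h
  rwa [div_le_iff₀ (by linarith)] at h

theorem continuousOn_comp (hω : IsMajorant ω) {r : ℝ} (hr1 : r < 1) :
    ContinuousOn (fun s => ω (1 / (1 - s))) (Icc 0 r) := by
  refine hω.continuousOn.comp (continuousOn_const.div (by fun_prop) ?_) ?_
  · intro s hs
    have := hs.2
    linarith
  · intro s hs
    have : 0 ≤ 1 - s := by linarith [hs.2]
    exact mem_Ici.2 (by positivity)

/-- The integral of `ω (1 / (1 - s))` over `[0, r]` is `r T(r)`, hence at most `T(r)`. -/
theorem integral_le_T (hω : IsMajorant ω) {r : ℝ} (hr0 : 0 < r) (hr1 : r < 1) :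
    0 ≤ T ω r ∧ ∫ s in (0 : ℝ)..r, ω (1 / (1 - s)) ≤ T ω r := by
  have h0 : 0 ≤ T ω r := by
    refine intervalIntegral.integral_nonneg zero_le_one fun s hs => hω.nonneg _ ?_
    have : s * r ≤ 1 * 1 := mul_le_mul hs.2 hr1.le hr0.le zero_le_one
    have : 0 ≤ 1 - s * r := by linarith
    positivity
  refine ⟨h0, ?_⟩
  have h := intervalIntegral.integral_comp_mul_right (a := 0) (b := 1)
    (fun s => ω (1 / (1 - s))) hr0.ne'
  simp only [zero_mul, one_mul] at h
  have : T ω r = r⁻¹ • ∫ s in (0 : ℝ)..r, ω (1 / (1 - s)) := h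
  have h2 : ∫ s in (0 : ℝ)..r, ω (1 / (1 - s)) = r * T ω r := by
    rw [this, smul_eq_mul, mul_inv_cancel_left₀ hr0.ne']
  rw [h2]
  nlinarith

end IsMajorant

/-! ### Growth of the integral means -/

section Regularized

variable {n : ℕ} {p lam C r : ℝ} {ω : ℝ → ℝ} {f : Cn n → ℂ}

/-- The growth estimate for the means `Φ` of `(‖f‖² + ε)^{p/2}`, before division by
`Φ(r)^{1 - 2/p}`. -/
theorem sphereMean_regPow_le {ε : ℝ} (hn : 1 ≤ n) (hp : 2 ≤ p) (hlam0 : 0 ≤ lam)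
    (hω : IsMajorant ω) (hf : ContDiff ℝ 2 f)
    (heq : ∀ z, ‖z‖ < r → Laplacian.laplacian f z = (lam : ℂ) * f z)
    (hgrad : ∀ s, 0 < s → s < r → integralMean p s (gradNorm f) ≤ C * ω (1 / (1 - s)))
    (hr0 : 0 < r) (hr1 : r < 1) (hε : 0 < ε) :
    sphereMean (sphereMeasure n) (regPow p ε f) 0 ≤ sphereMean (sphereMeasure n) (regPow p ε f) r ∧
    sphereMean (sphereMeasure n) (regPow p ε f) r ≤
      sphereMean (sphereMeasure n) (regPow p ε f) 0
      + p * lam / (4 * n) * sphereMean (sphereMeasure n) (regPow p ε f) r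
      + 2 * p * (p - 1) * C ^ 2 * ω 1 * T ω r *
        sphereMean (sphereMeasure n) (regPow p ε f) r ^ (1 - 2 / p) := by
  have := isProbabilityMeasure_sphereMeasure hn
  set σ := sphereMeasure n
  set u := regPow p ε f
  set Φ := sphereMean σ u
  set L : ℝ → ℝ := fun s =>
    ∫ ζ, ∑ i, fderiv ℝ (fderiv ℝ u) (s • (ζ : Cn n)) (realBasis n i) (realBasis n i) ∂σ
  have hu : ContDiff ℝ 2 u := contDiff_regPow hf hε
  have hf1 : ContDiff ℝ 1 f := hf.of_le (by norm_num)
  have hu1 : ContDiff ℝ 1 (fderiv ℝ u) := hu.fderiv_right (by norm_num)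
  obtain ⟨k, rfl⟩ : ∃ k, n = k + 1 := ⟨n - 1, by omega⟩
  -- The real dimension is `2 (k + 1) = 2 k + 2`.
  have h0 := hasDerivAt_sphereMean (σ := σ) (hu.of_le (by norm_num : (1 : WithTop ℕ∞) ≤ 2))
  have h1 := hasDerivAt_integral_fderiv_radial (σ := σ) hu
  have hode : ∀ s, s * ∫ ζ, fderiv ℝ (fderiv ℝ u) (s • (ζ : Cn (k + 1))) ζ ζ ∂σ
      + (((2 * k : ℕ) : ℝ) + 1) * ∫ ζ, fderiv ℝ u (s • (ζ : Cn (k + 1))) ζ ∂σ = s * L s := by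
    intro s
    rw [← integral_radial_laplacian (realBasis (k + 1)) (rotationInvariant_sphereMeasure (k + 1))
      hu s, card_realBasis]
    push_cast
    ring
  have hpde : ∀ s ∈ Ioo 0 r, ∀ ζ : sphere (0 : Cn (k + 1)) 1,
      ∑ i, fderiv ℝ (fderiv ℝ f) (s • (ζ : Cn (k + 1))) (realBasis _ i) (realBasis _ i) =
        lam • f (s • (ζ : Cn (k + 1))) := by
    intro s hs ζ
    rw [← laplacian_eq_sum_realBasis, heq, Complex.real_smul]
    rw [norm_smul, norm_eq_of_mem_sphere, Real.norm_of_nonneg hs.1.le, mul_one]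
    exact hs.2
  have hmono : MonotoneOn Φ (Icc 0 r) := radial_monotoneOn (m := 2 * k) h0 h1 hode fun s hs =>
    integral_nonneg fun ζ => sum_fderiv_fderiv_regPow_nonneg hf hε hp hlam0 (hpde s hs ζ)
  have hr : r ∈ Icc 0 r := ⟨hr0.le, le_rfl⟩
  have hΦ0 : ∀ s, 0 ≤ Φ s := fun s => integral_nonneg fun ζ => by
    simp only [u, regPow]
    positivity
  refine ⟨hmono ⟨le_rfl, hr0.le⟩ hr hr0.le, ?_⟩
  have hω1 : 0 ≤ ω 1 := hω.nonneg 1 zero_le_one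
  have hp1 : 0 ≤ p - 1 := by linarith
  have hp0 : 0 ≤ p := by linarith
  have hexp : 0 ≤ 1 - 2 / p := by
    rw [sub_nonneg, div_le_one (by linarith)]
    exact hp
  -- As `ω(t) ≤ ω(1) t` for `t ≥ 1`, the function `ω(1/(1-s))²` is at most `ω(1)` times this weight;
  -- it is extended by constants outside `[0, r]` to be continuous on the whole line.
  set q : ℝ → ℝ := IccExtend hr0.le fun s : Icc 0 r => ω (1 / (1 - s)) / (1 - s)
  have hqc : Continuous q := by
    refine Continuous.Icc_extend' ?_
    refine (continuousOn_iff_continuous_domRestrict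
      (f := fun s : ℝ => ω (1 / (1 - s)) / (1 - s))).1 ?_
    refine (hω.continuousOn_comp hr1).div (by fun_prop) fun s hs => ?_
    have := hs.2
    linarith
  have hq0 : ∀ s, 0 ≤ q s := fun s => by
    simp only [q, IccExtend, Function.comp_apply]
    have h2 := (projIcc 0 r hr0.le s).2.2
    have h3 : 0 ≤ 1 - (projIcc 0 r hr0.le s : ℝ) := by linarith
    have := hω.nonneg (1 / (1 - (projIcc 0 r hr0.le s : ℝ))) (by positivity)
    positivity
  have hqe : ∀ s ∈ Icc 0 r, q s = ω (1 / (1 - s)) / (1 - s) := fun s hs =>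
    IccExtend_of_mem hr0.le _ hs
  set B : ℝ := 2 * p * (p - 1) * C ^ 2 * ω 1 * Φ r ^ (1 - 2 / p)
  have hΦr := Real.rpow_nonneg (hΦ0 r) (1 - 2 / p)
  have hB : 0 ≤ B := by positivity
  have hL : ∀ s ∈ Ioo 0 r, L s ≤ p * lam * Φ r + B * q s := by
    intro s hs
    have hs' : s ∈ Icc 0 r := Ioo_subset_Icc_self hs
    have hs1 : 0 < 1 - s := by linarith [hs.2]
    have hcg : Continuous fun ζ : sphere (0 : Cn (k + 1)) 1 => gradNorm f (s • (ζ : Cn (k + 1))) :=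
      (continuous_gradNorm hf1).comp (by fun_prop)
    have hcf : Continuous fun ζ : sphere (0 : Cn (k + 1)) 1 => f (s • (ζ : Cn (k + 1))) :=
      hf.continuous.comp (by fun_prop)
    have hcu : Continuous fun ζ : sphere (0 : Cn (k + 1)) 1 => u (s • (ζ : Cn (k + 1))) :=
      hu.continuous.comp (by fun_prop)
    have hcL : Continuous fun ζ : sphere (0 : Cn (k + 1)) 1 =>
        fderiv ℝ (fderiv ℝ u) (s • (ζ : Cn (k + 1))) :=
      (hu1.continuous_fderiv one_ne_zero).comp (by fun_prop)
    have hcv : Continuous fun ζ : sphere (0 : Cn (k + 1)) 1 =>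
        (‖f (s • (ζ : Cn (k + 1)))‖ ^ 2 + ε) ^ (p / 2 - 1) :=
      Continuous.rpow_const (by fun_prop) fun ζ => Or.inl (by positivity)
    have hg0 : ∀ z, 0 ≤ gradNorm f z := fun z => Real.sqrt_nonneg _
    have hH := integral_rpow_mul_sq_le (μ := σ)
      (v := fun ζ : sphere (0 : Cn (k + 1)) 1 => ‖f (s • (ζ : Cn (k + 1)))‖ ^ 2 + ε)
      (by fun_prop) hcg (fun ζ => by positivity) (fun ζ => hg0 _) hp
    have hM : (∫ ζ, gradNorm f (s • (ζ : Cn (k + 1))) ^ p ∂σ) ^ (1 / p) ≤ C * ω (1 / (1 - s)) := by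
      have := hgrad s hs.1 hs.2
      simpa only [integralMean, Real.norm_of_nonneg (hg0 _)] using this
    have hM0 : 0 ≤ (∫ ζ, gradNorm f (s • (ζ : Cn (k + 1))) ^ p ∂σ) ^ (1 / p) :=
      Real.rpow_nonneg (integral_nonneg fun ζ => Real.rpow_nonneg (hg0 _) _) _
    have hωs := hω.nonneg (1 / (1 - s)) (by positivity)
    have hωle : ω (1 / (1 - s)) ≤ ω 1 * (1 / (1 - s)) :=
      hω.le_mul (by rw [le_div_iff₀ hs1]; linarith [hs.1])
    have hH' : ∫ ζ, (‖f (s • (ζ : Cn (k + 1)))‖ ^ 2 + ε) ^ (p / 2 - 1) *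
        gradNorm f (s • (ζ : Cn (k + 1))) ^ 2 ∂σ ≤ Φ r ^ (1 - 2 / p) * (C ^ 2 * (ω 1 * q s)) := by
      refine hH.trans (mul_le_mul ?_ ?_ (sq_nonneg _) hΦr)
      · exact Real.rpow_le_rpow (hΦ0 s) (hmono hs' hr hs.2.le) hexp
      · calc _ ≤ (C * ω (1 / (1 - s))) ^ 2 := pow_le_pow_left₀ hM0 hM 2
          _ = C ^ 2 * (ω (1 / (1 - s)) * ω (1 / (1 - s))) := by ring
          _ ≤ C ^ 2 * (ω 1 * (1 / (1 - s)) * ω (1 / (1 - s))) := by gcongr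
          _ = _ := by rw [hqe s hs']; ring
    calc L s ≤ ∫ ζ, (p * lam * u (s • (ζ : Cn (k + 1))) + 2 * p * (p - 1) *
          ((‖f (s • (ζ : Cn (k + 1)))‖ ^ 2 + ε) ^ (p / 2 - 1) *
            gradNorm f (s • (ζ : Cn (k + 1))) ^ 2)) ∂σ := by
          refine integral_mono (integrable_of_continuous_sphere (by fun_prop))
            (integrable_of_continuous_sphere (by fun_prop)) fun ζ => ?_
          refine (sum_fderiv_fderiv_regPow_le hf hε hp hlam0 (hpde s hs ζ)).trans (le_of_eq ?_)
          rw [gradNorm_sq]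
          ring
      _ = p * lam * Φ s + 2 * p * (p - 1) *
          ∫ ζ, (‖f (s • (ζ : Cn (k + 1)))‖ ^ 2 + ε) ^ (p / 2 - 1) *
            gradNorm f (s • (ζ : Cn (k + 1))) ^ 2 ∂σ := by
          rw [integral_add, integral_const_mul, integral_const_mul]
          · rfl
          all_goals exact integrable_of_continuous_sphere (by fun_prop)
      _ ≤ p * lam * Φ r + 2 * p * (p - 1) * (Φ r ^ (1 - 2 / p) * (C ^ 2 * (ω 1 * q s))) := by
          gcongr
          exact hmono hs' hr hs.2.le
      _ = _ := by simp only [B]; ring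
  have hcmp := radial_comparison (m := 2 * k) h0 h1 hode hB hqc hq0 hL hr0.le hr1.le
  have hint : ∫ s in (0 : ℝ)..r, (1 - s) * q s = ∫ s in (0 : ℝ)..r, ω (1 / (1 - s)) := by
    refine intervalIntegral.integral_congr fun s hs => ?_
    rw [uIcc_of_le hr0.le] at hs
    have : 1 - s ≠ 0 := by linarith [hs.2]
    simp only [hqe s hs]
    field_simp
  rw [hint] at hcmp
  have hT := mul_le_mul_of_nonneg_left (hω.integral_le_T hr0 hr1).2 hB
  have hA : p * lam * Φ r * r ^ 2 / (2 * (((2 * k : ℕ) : ℝ) + 2)) ≤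
      p * lam / (4 * ((k + 1 : ℕ) : ℝ)) * Φ r := by
    have e : p * lam / (4 * ((k + 1 : ℕ) : ℝ)) * Φ r =
        p * lam * Φ r * 1 / (2 * (((2 * k : ℕ) : ℝ) + 2)) := by
      push_cast
      field_simp
      ring
    rw [e]
    have := hΦ0 r
    gcongr
    nlinarith
  have hBT : B * T ω r = 2 * p * (p - 1) * C ^ 2 * ω 1 * T ω r * Φ r ^ (1 - 2 / p) := by
    simp only [B]
    ring
  linarith

/-- The growth estimate for a globally `C²` function that solves the equation on the ball of
radius `r` only. -/
theorem integralMean_sq_le_of_contDiff (hn : 1 ≤ n) (hp : 2 ≤ p) (hlam0 : 0 ≤ lam)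
    (hlam : lam < 4 * (n : ℝ) / p)
    (hω : IsMajorant ω) (hf : ContDiff ℝ 2 f)
    (heq : ∀ z, ‖z‖ < r → Laplacian.laplacian f z = (lam : ℂ) * f z)
    (hgrad : ∀ s, 0 < s → s < r → integralMean p s (gradNorm f) ≤ C * ω (1 / (1 - s)))
    (hr0 : 0 < r) (hr1 : r < 1) :
    integralMean p r f ^ 2 ≤ 4 * (n : ℝ) / (4 * (n : ℝ) - p * lam) *
      (‖f 0‖ ^ 2 + 2 * p * (p - 1) * C ^ 2 * ω 1 * T ω r) := by
  have hn0 : (0 : ℝ) < n := by exact_mod_cast hn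
  have hp0 : 0 < p := by linarith
  have hden : 0 < 4 * (n : ℝ) - p * lam := by
    rw [lt_div_iff₀ hp0] at hlam
    linarith
  have hprob := isProbabilityMeasure_sphereMeasure hn
  set D := 2 * p * (p - 1) * C ^ 2 * ω 1 * T ω r
  set K := 4 * (n : ℝ) / (4 * (n : ℝ) - p * lam)
  have hK : 0 < K := by positivity
  -- The estimate at the regularization parameter `ε = δ / K` loses exactly `δ`.
  refine le_of_forall_pos_le_add fun δ hδ => ?_
  set ε := δ / K
  have hε : 0 < ε := by positivity
  obtain ⟨hm, hle⟩ := sphereMean_regPow_le hn hp hlam0 hω hf heq hgrad hr0 hr1 hε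
  set a := sphereMean (sphereMeasure n) (regPow p ε f) r
  have h0 : sphereMean (sphereMeasure n) (regPow p ε f) 0 = (‖f 0‖ ^ 2 + ε) ^ (p / 2) := by
    simp [sphereMean, regPow]
  rw [h0] at hm hle
  set v := ‖f 0‖ ^ 2 + ε with hv_def
  have hv : 0 < v := by positivity
  have hb : 0 < v ^ (p / 2) := by positivity
  have ha : 0 < a := hb.trans_le hm
  have hexp : 0 ≤ 1 - 2 / p := by
    rw [sub_nonneg, div_le_one hp0]
    exact hp
  have hsplit : v ^ (p / 2) ≤ v * a ^ (1 - 2 / p) := by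
    have h1 : v * (v ^ (p / 2)) ^ (1 - 2 / p) = v ^ (p / 2) := by
      rw [← Real.rpow_mul hv.le]
      nth_rewrite 1 [← Real.rpow_one v]
      rw [← Real.rpow_add hv]
      congr 1
      field_simp
      ring
    calc v ^ (p / 2) = v * (v ^ (p / 2)) ^ (1 - 2 / p) := h1.symm
      _ ≤ _ := by gcongr
  have hasplit : a = a ^ (2 / p) * a ^ (1 - 2 / p) := by
    rw [← Real.rpow_add ha]
    simp
  have hc : 0 < a ^ (1 - 2 / p) := by positivity
  -- Divided by `a ^ (1 - 2 / p)` the inequality becomes linear in `a ^ (2 / p)`.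
  have hX : a ^ (2 / p) * (1 - p * lam / (4 * n)) ≤ v + D := by
    refine le_of_mul_le_mul_right ?_ hc
    have e : a ^ (2 / p) * (1 - p * lam / (4 * n)) * a ^ (1 - 2 / p) =
        a - p * lam / (4 * n) * a := by
      linear_combination (-(1 - p * lam / (4 * n))) * hasplit
    rw [e, add_mul]
    linarith
  have hX' : a ^ (2 / p) ≤ K * (v + D) := by
    have e : K * (1 - p * lam / (4 * n)) = 1 := by
      simp only [K]
      field_simp
    calc a ^ (2 / p) = K * (a ^ (2 / p) * (1 - p * lam / (4 * n))) := by
          linear_combination -(a ^ (2 / p)) * e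
      _ ≤ _ := by gcongr
  have hcf : Continuous fun ζ : sphere (0 : Cn n) 1 => f (r • (ζ : Cn n)) :=
    hf.continuous.comp (by fun_prop)
  have hcu : Continuous fun ζ : sphere (0 : Cn n) 1 => regPow p ε f (r • (ζ : Cn n)) :=
    (contDiff_regPow hf hε).continuous.comp (by fun_prop)
  have hI : ∫ ζ : sphere (0 : Cn n) 1, ‖f (r • (ζ : Cn n))‖ ^ p ∂(sphereMeasure n) ≤ a := by
    refine integral_mono (integrable_of_continuous_sphere
      (hcf.norm.rpow_const fun _ => Or.inr hp0.le))
      (integrable_of_continuous_sphere hcu) fun ζ => ?_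
    have e : ‖f (r • (ζ : Cn n))‖ ^ p = (‖f (r • (ζ : Cn n))‖ ^ 2) ^ (p / 2) := by
      rw [← Real.rpow_natCast, ← Real.rpow_mul (norm_nonneg _)]
      congr 1
      push_cast
      ring
    simp only [e, regPow]
    gcongr
    linarith
  have hI0 : 0 ≤ ∫ ζ : sphere (0 : Cn n) 1, ‖f (r • (ζ : Cn n))‖ ^ p ∂(sphereMeasure n) :=
    integral_nonneg fun ζ => by positivity
  calc integralMean p r f ^ 2
      = (∫ ζ : sphere (0 : Cn n) 1, ‖f (r • (ζ : Cn n))‖ ^ p ∂(sphereMeasure n)) ^ (2 / p) := by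
        rw [integralMean, ← Real.rpow_natCast, ← Real.rpow_mul hI0]
        congr 1
        push_cast
        ring
    _ ≤ a ^ (2 / p) := Real.rpow_le_rpow hI0 hI (by positivity)
    _ ≤ K * (v + D) := hX'
    _ = K * (‖f 0‖ ^ 2 + D) + δ := by
        have : K * ε = δ := mul_div_cancel₀ δ hK.ne'
        rw [hv_def]
        linear_combination this

end Regularized

end Yukawa

theorem theorem1p1 (n : ℕ) (hn : 1 ≤ n) (p : ℝ) (hp : 2 ≤ p)
    (lam : ℝ) (hlam0 : 0 ≤ lam) (hlam : lam < 4 * (n : ℝ) / p)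
    (ω : ℝ → ℝ) (hω : Yukawa.IsMajorant ω)
    (f : Yukawa.Cn n → ℂ) (hf : Yukawa.IsSolution lam f)
    (C : ℝ) (hC : 0 < C)
    (hgrad : ∀ r : ℝ, 0 < r → r < 1 →
      Yukawa.integralMean p r (Yukawa.gradNorm f) ≤ C * ω (1 / (1 - r))) :
    ∀ r : ℝ, 0 < r → r < 1 →
      Yukawa.integralMean p r f ≤
        (4 * (n : ℝ) / (4 * (n : ℝ) - p * lam)) ^ (1 / 2 : ℝ) *
          (‖f 0‖ ^ 2 + 2 * p * (p - 1) * C ^ 2 * ω 1 * Yukawa.T ω r) ^ (1 / 2 : ℝ) := by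
  intro r hr0 hr1
  have hn0 : (0 : ℝ) < n := by exact_mod_cast hn
  have hp0 : 0 < p := by linarith
  have hp1 : 0 ≤ p - 1 := by linarith
  have hden : 0 < 4 * (n : ℝ) - p * lam := by
    rw [lt_div_iff₀ hp0] at hlam
    linarith
  obtain ⟨g, hg, hgf⟩ := Yukawa.exists_contDiff_eqOn_ball hf.contDiffOn hr0 hr1
  have hnhds : ∀ z : Yukawa.Cn n, ‖z‖ < r → g =ᶠ[nhds z] f := fun z hz => by
    filter_upwards [Metric.isOpen_ball.mem_nhds (mem_ball_zero_iff.2 hz)] with y hy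
    exact hgf (Metric.ball_subset_closedBall hy)
  have heq : ∀ z : Yukawa.Cn n, ‖z‖ < r → Laplacian.laplacian g z = (lam : ℂ) * g z := by
    intro z hz
    rw [(InnerProductSpace.laplacian_congr_nhds (hnhds z hz)).eq_of_nhds,
      (hnhds z hz).eq_of_nhds]
    exact hf.laplacian_eq z (mem_ball_zero_iff.2 (hz.trans hr1))
  have hsph : ∀ s, 0 < s → ∀ ζ : Metric.sphere (0 : Yukawa.Cn n) 1,
      ‖s • (ζ : Yukawa.Cn n)‖ = s := fun s hs ζ => by
    rw [norm_smul, norm_eq_of_mem_sphere, Real.norm_of_nonneg hs.le, mul_one]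
  have hgg : ∀ s, 0 < s → s < r →
      Yukawa.integralMean p s (Yukawa.gradNorm g) ≤ C * ω (1 / (1 - s)) := by
    intro s hs hsr
    refine le_of_eq_of_le ?_ (hgrad s hs (hsr.trans hr1))
    have : ∀ ζ : Metric.sphere (0 : Yukawa.Cn n) 1,
        Yukawa.gradNorm g (s • (ζ : Yukawa.Cn n)) = Yukawa.gradNorm f (s • (ζ : Yukawa.Cn n)) := by
      intro ζ
      rw [Yukawa.gradNorm_eq, Yukawa.gradNorm_eq,
        (hnhds _ ((hsph s hs ζ).trans_lt hsr)).fderiv_eq]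
    simp only [Yukawa.integralMean, this]
  have hmain := Yukawa.integralMean_sq_le_of_contDiff hn hp hlam0 hlam hω hg heq hgg hr0 hr1
  have hfg : Yukawa.integralMean p r g = Yukawa.integralMean p r f := by
    have : ∀ ζ : Metric.sphere (0 : Yukawa.Cn n) 1,
        g (r • (ζ : Yukawa.Cn n)) = f (r • (ζ : Yukawa.Cn n)) := fun ζ =>
      hgf (mem_closedBall_zero_iff.2 (hsph r hr0 ζ).le)
    simp only [Yukawa.integralMean, this]
  rw [hfg, hgf (Metric.mem_closedBall_self hr0.le)] at hmain
  have hT := (hω.integral_le_T hr0 hr1).1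
  have hω1 := hω.nonneg 1 zero_le_one
  rw [← Real.mul_rpow (by positivity) (by positivity), ← Real.sqrt_eq_rpow]
  exact Real.le_sqrt_of_sq_le hmain
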